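/- Let $\mathsf L_0=1,\mathsf L_1,\mathsf L_2,\ldots$ be the Hirzebruch $L$-polynomials, i.e. the multiplicative sequence of polynomials (with rational coefficients, in variables $\mathsf p_1,\mathsf p_2,\ldots$ with $\mathsf p_i$ of degree $i$) whose characteristic power series is $\sqrt z/\tanh\sqrt z$. For $k\ge 1$ write $$\mathsf L_k=\sum h_{j_1,\ldots,j_r}\,\mathsf p_{j_1}\cdots\mathsf p_{j_r},$$ where the sum is over all partitions of $k$, that is, sequences of integers $j_1\ge\cdots\ge j_r\ge 1$ with $j_1+\cdots+j_r=k$. For real numbers $s_1,\ldots,s_r>1$ put $$T(s_1,\ldots,s_r)=\sum_{n_1\ge_2\cdots\ge_2 n_r\ge 1}\frac{(-1)^{n_1+\cdots+n_r}}{n_1^{s_1}\cdots n_r^{s_r}},\qquad T^\Sigma(s_1,\ldots,s_r)=\sum_{\sigma\in\Sigma_r}T(s_{\sigma_1},\ldots,s_{\sigma_r}),$$ where the $n_i$ are integers, $n\ge_2 m$ means that $n\ge m$ with equality only if $n$ is even, and $\Sigma_r$ is the symmetric group. Then for every $k\ge 1$ and every partition $(j_1,\ldots,j_r)$ of $k$,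 the series $T(2j_{\sigma_1},\ldots,2j_{\sigma_r})$, $\sigma\in\Sigma_r$, converge absolutely, and $$h_{j_1,\ldots,j_r}=\frac{(-1)^r}{\alpha_1!\cdots\alpha_k!}\,\frac{2^{2k}}{\pi^{2k}}\,T^\Sigma(2j_1,\ldots,2j_r),$$ where $\alpha_\ell$ counts how many of $j_1,\ldots,j_r$ are equal to $\ell$. -/

import Mathlib

namespace Hirz

/-! ### Multiplicative sequences of polynomials -/

/-- The weight of the variable `p_j` is `j`. -/
def wt (j : ℕ+) : ℕ := (j : ℕ)

/-- `K (1 + a₁ z + a₂ z² + ⋯) = ∑ₖ K_k(a₁, …, a_k) zᵏ`, for a sequence of polynomials `K_k` in the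
variables `p₁, p₂, …`. -/
noncomputable def evalSeries (K : ℕ → MvPolynomial ℕ+ ℚ) {A : Type} [CommRing A] [Algebra ℚ A]
    (f : PowerSeries A) : PowerSeries A :=
  PowerSeries.mk fun k => MvPolynomial.aeval (fun j : ℕ+ => PowerSeries.coeff (j : ℕ) f) (K k)

/-- Multiplicative sequences of polynomials with rational coefficients: `K_0 = 1`, the polynomial
`K_k` is homogeneous of degree `k` when `p_j` has degree `j` (so only `p₁, …, p_k` occur in it), and
`f ↦ K f` is multiplicative on power series with constant term `1` over commutative algebras. -/
structure IsMultiplicativeSequence (K : ℕ → MvPolynomial ℕ+ ℚ) : Prop where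
  zero : K 0 = 1
  homogeneous : ∀ k, MvPolynomial.IsWeightedHomogeneous wt (K k) k
  mul : ∀ (A : Type) [CommRing A] [Algebra ℚ A] (f g : PowerSeries A),
    PowerSeries.constantCoeff f = 1 → PowerSeries.constantCoeff g = 1 →
      evalSeries K (f * g) = evalSeries K f * evalSeries K g

/-- The characteristic power series `K (1 + z)`. -/
noncomputable def charSeries (K : ℕ → MvPolynomial ℕ+ ℚ) : PowerSeries ℚ :=
  evalSeries K (1 + PowerSeries.X)

section Existence

variable {A : Type} [CommRing A]

/-- The coefficients of the logarithmic derivative of `1 + a₁ z + a₂ z² + ⋯`. -/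
def logDer (a : ℕ → A) : ℕ → A
  | n => (n + 1 : A) * a (n + 1) - ∑ i : Fin n, a (n - i) * logDer a i

theorem logDer_eq (a : ℕ → A) (n : ℕ) :
    logDer a n = (n + 1 : A) * a (n + 1) - ∑ i ∈ Finset.range n, a (n - i) * logDer a i := by
  rw [logDer, Finset.sum_range]

theorem mul_mk_iff (f g : PowerSeries A) (hf : PowerSeries.constantCoeff f = 1) (u : ℕ → A) :
    f * PowerSeries.mk u = g ↔ ∀ n, u n = PowerSeries.coeff n g -
      ∑ i ∈ Finset.range n, PowerSeries.coeff (n - i) f * u i := by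
  rw [PowerSeries.ext_iff]
  refine forall_congr' fun n => ?_
  rw [mul_comm, PowerSeries.coeff_mul,
    Finset.Nat.sum_antidiagonal_eq_sum_range_succ_mk, Finset.sum_range_succ]
  simp only [PowerSeries.coeff_mk, Nat.sub_self, PowerSeries.coeff_zero_eq_constantCoeff_apply, hf,
    mul_one]
  rw [eq_sub_iff_add_eq, add_comm]
  simp only [mul_comm]

/-- The logarithmic derivative of a power series with constant term `1`. -/
noncomputable def logDerS (f : PowerSeries A) : ℕ → A := logDer fun n => PowerSeries.coeff n f

theorem mul_logDerS_iff (f : PowerSeries A) (hf : PowerSeries.constantCoeff f = 1) (u : ℕ → A) :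
    f * PowerSeries.mk u = PowerSeries.derivative A f ↔ u = logDerS f := by
  rw [mul_mk_iff f _ hf]
  have key : ∀ n, PowerSeries.coeff n (PowerSeries.derivative A f)
      = (n + 1 : A) * PowerSeries.coeff (n + 1) f := fun n => by
    rw [PowerSeries.coeff_derivative, mul_comm]
  simp only [key]
  constructor
  · intro h
    funext n
    induction n using Nat.strong_induction_on with
    | _ n ih =>
      rw [h n, logDerS, logDer_eq]
      congr 1
      refine Finset.sum_congr rfl fun i hi => ?_
      rw [ih i (Finset.mem_range.1 hi), logDerS]
  · rintro rfl n
    rw [logDerS, logDer_eq]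

theorem logDerS_mul (f g : PowerSeries A) (hf : PowerSeries.constantCoeff f = 1)
    (hg : PowerSeries.constantCoeff g = 1) : logDerS (f * g) = logDerS f + logDerS g := by
  symm
  rw [← mul_logDerS_iff _ (by simp [hf, hg])]
  have h1 := (mul_logDerS_iff f hf _).2 rfl
  have h2 := (mul_logDerS_iff g hg _).2 rfl
  have h3 : PowerSeries.mk (logDerS f + logDerS g)
      = PowerSeries.mk (logDerS f) + PowerSeries.mk (logDerS g) := by
    ext n; simp
  rw [h3, Derivation.leibniz, ← h1, ← h2]
  simp only [smul_eq_mul]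
  ring

theorem map_logDer {B : Type} [CommRing B] (φ : A →+* B) (a : ℕ → A) (n : ℕ) :
    φ (logDer a n) = logDer (fun m => φ (a m)) n := by
  induction n using Nat.strong_induction_on with
  | _ n ih =>
    rw [logDer_eq, logDer_eq]
    simp only [map_sub, map_mul, map_add, map_natCast, map_one, map_sum]
    congr 1
    exact Finset.sum_congr rfl fun i hi => by rw [ih i (Finset.mem_range.1 hi)]

variable [Algebra ℚ A]

/-- The coefficients of the solution of `F' = (∑ cₙ zⁿ) F` with constant term `1`. -/
noncomputable def expInt (c : ℕ → A) : ℕ → A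
  | 0 => 1
  | n + 1 => algebraMap ℚ A (1 / (n + 1)) * ∑ i : Fin (n + 1), c (n - i) * expInt c i

theorem expInt_succ (c : ℕ → A) (n : ℕ) : expInt c (n + 1) =
    algebraMap ℚ A (1 / (n + 1)) * ∑ i ∈ Finset.range (n + 1), c (n - i) * expInt c i := by
  rw [expInt, Finset.sum_range]

theorem expInt_iff (F : PowerSeries A) (hF : PowerSeries.constantCoeff F = 1) (c : ℕ → A) :
    PowerSeries.derivative A F = PowerSeries.mk c * F ↔ F = PowerSeries.mk (expInt c) := by
  have key : ∀ n : ℕ, algebraMap ℚ A (1 / (n + 1)) * (n + 1 : A) = 1 := fun n => by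
    have : (n + 1 : A) = algebraMap ℚ A (n + 1) := by simp
    rw [this, ← map_mul, one_div, inv_mul_cancel₀ (by positivity), map_one]
  have hd : ∀ G : PowerSeries A, PowerSeries.derivative A G = PowerSeries.mk c * G ↔
      ∀ n, PowerSeries.coeff (n + 1) G = algebraMap ℚ A (1 / (n + 1)) *
        ∑ i ∈ Finset.range (n + 1), c (n - i) * PowerSeries.coeff i G := fun G => by
    rw [PowerSeries.ext_iff]
    refine forall_congr' fun n => ?_
    rw [PowerSeries.coeff_derivative, mul_comm (PowerSeries.mk c), PowerSeries.coeff_mul,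
      Finset.Nat.sum_antidiagonal_eq_sum_range_succ_mk]
    simp only [PowerSeries.coeff_mk]
    simp only [mul_comm (PowerSeries.coeff _ G) (c _)]
    constructor
    · intro h
      rw [← h, mul_comm, mul_assoc, mul_comm _ (algebraMap ℚ A _), key, mul_one]
    · intro h
      rw [h, mul_right_comm, key, one_mul]
  rw [hd]
  constructor
  · intro h
    ext n
    rw [PowerSeries.coeff_mk]
    induction n using Nat.strong_induction_on with
    | _ n ih =>
      cases n with
      | zero => simpa [expInt] using hF
      | succ n =>
        rw [h n, expInt_succ]
        congr 1
        exact Finset.sum_congr rfl fun i hi => by rw [ih i (Finset.mem_range.1 hi)]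
  · rintro rfl n
    simp only [PowerSeries.coeff_mk]
    rw [expInt_succ]

theorem mk_expInt_add (c d : ℕ → A) : PowerSeries.mk (expInt (c + d)) =
    PowerSeries.mk (expInt c) * PowerSeries.mk (expInt d) := by
  have h0 : ∀ c : ℕ → A, PowerSeries.constantCoeff (PowerSeries.mk (expInt c)) = 1 := fun c => by
    rw [← PowerSeries.coeff_zero_eq_constantCoeff_apply, PowerSeries.coeff_mk, expInt]
  symm
  rw [← expInt_iff _ (by simp [h0]), Derivation.leibniz, (expInt_iff _ (h0 c) c).2 rfl,
    (expInt_iff _ (h0 d) d).2 rfl]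
  have h3 : PowerSeries.mk (c + d) = PowerSeries.mk c + PowerSeries.mk d := by
    ext n; simp
  rw [h3]
  simp only [smul_eq_mul]
  ring

theorem map_expInt {B : Type} [CommRing B] [Algebra ℚ B] (φ : A →ₐ[ℚ] B) (c : ℕ → A) (n : ℕ) :
    φ (expInt c n) = expInt (fun m => φ (c m)) n := by
  induction n using Nat.strong_induction_on with
  | _ n ih =>
    cases n with
    | zero => simp [expInt]
    | succ n =>
      rw [expInt_succ, expInt_succ, map_mul, map_sum, AlgHom.commutes]
      congr 1
      exact Finset.sum_congr rfl fun i hi => by rw [map_mul, ih i (Finset.mem_range.1 hi)]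

end Existence

/-- The coefficients of `1 + p₁ z + p₂ z² + ⋯`. -/
noncomputable def universalCoeff (n : ℕ) : MvPolynomial ℕ+ ℚ :=
  if h : 0 < n then MvPolynomial.X (Nat.toPNat n h) else 1

theorem universalCoeff_homogeneous (n : ℕ) :
    MvPolynomial.IsWeightedHomogeneous wt (universalCoeff n) n := by
  unfold universalCoeff
  split_ifs with h
  · exact MvPolynomial.isWeightedHomogeneous_X ℚ wt (Nat.toPNat n h)
  · obtain rfl : n = 0 := by omega
    exact MvPolynomial.isWeightedHomogeneous_one ℚ wt

theorem logDer_homogeneous (n : ℕ) :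
    MvPolynomial.IsWeightedHomogeneous wt (logDer universalCoeff n) (n + 1) := by
  induction n using Nat.strong_induction_on with
  | _ n ih =>
    rw [logDer_eq]
    have hC : (n + 1 : MvPolynomial ℕ+ ℚ) = MvPolynomial.C (n + 1 : ℚ) := by simp
    refine MvPolynomial.IsWeightedHomogeneous.sub ?_
      (MvPolynomial.IsWeightedHomogeneous.sum _ _ _ fun i hi => ?_)
    · rw [hC]
      exact (universalCoeff_homogeneous (n + 1)).C_mul _
    · have hi' := Finset.mem_range.1 hi
      have := (universalCoeff_homogeneous (n - i)).mul (ih i hi')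
      rwa [show n - i + (i + 1) = n + 1 by omega] at this

theorem expInt_homogeneous (c : ℕ → MvPolynomial ℕ+ ℚ)
    (hc : ∀ n, MvPolynomial.IsWeightedHomogeneous wt (c n) (n + 1)) (n : ℕ) :
    MvPolynomial.IsWeightedHomogeneous wt (expInt c n) n := by
  induction n using Nat.strong_induction_on with
  | _ n ih =>
    cases n with
    | zero => rw [expInt]; exact MvPolynomial.isWeightedHomogeneous_one ℚ wt
    | succ n =>
      rw [expInt_succ]
      refine MvPolynomial.IsWeightedHomogeneous.C_mul
        (MvPolynomial.IsWeightedHomogeneous.sum _ _ _ fun i hi => ?_) _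
      have hi' := Finset.mem_range.1 hi
      have := (hc (n - i)).mul (ih i hi')
      rwa [show n - i + 1 + i = n + 1 by omega] at this

theorem exists_multiplicativeSequence (Q : PowerSeries ℚ) (hQ : PowerSeries.constantCoeff Q = 1) :
    ∃ K, IsMultiplicativeSequence K ∧ charSeries K = Q := by
  let e : ℕ → ℚ := fun n => (-1) ^ n * logDerS Q n
  let K : ℕ → MvPolynomial ℕ+ ℚ :=
    expInt fun n => MvPolynomial.C (e n) * logDer universalCoeff n
  have hK : ∀ (A : Type) [CommRing A] [Algebra ℚ A] (f : PowerSeries A),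
      PowerSeries.constantCoeff f = 1 → evalSeries K f =
        PowerSeries.mk (expInt fun n => algebraMap ℚ A (e n) * logDerS f n) := by
    intro A _ _ f hf
    ext k
    simp only [evalSeries, PowerSeries.coeff_mk, K]
    rw [map_expInt]
    congr 1
    funext n
    have h := map_logDer (MvPolynomial.aeval (R := ℚ)
      (fun j : ℕ+ => PowerSeries.coeff (j : ℕ) f)).toRingHom universalCoeff n
    simp only [AlgHom.toRingHom_eq_coe, RingHom.coe_coe] at h
    rw [map_mul, MvPolynomial.algHom_C, h, logDerS]
    congr 2
    funext m
    unfold universalCoeff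
    split_ifs with hm
    · rw [MvPolynomial.aeval_X]; rfl
    · obtain rfl : m = 0 := by omega
      simp [hf]
  refine ⟨K, ⟨by simp [K, expInt], fun k => ?_, ?_⟩, ?_⟩
  · exact expInt_homogeneous _ (fun n => (logDer_homogeneous n).C_mul _) k
  · intro A _ _ f g hf hg
    rw [hK A _ (by simp [hf, hg]), hK A f hf, hK A g hg, ← mk_expInt_add, logDerS_mul f g hf hg]
    congr 2
    funext n
    simp [mul_add]
  · rw [charSeries, hK ℚ _ (by simp)]
    have h1 : logDerS (1 + PowerSeries.X : PowerSeries ℚ) = fun n => (-1) ^ n := by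
      symm
      rw [← mul_logDerS_iff _ (by simp)]
      ext n
      rw [add_mul, one_mul, map_add, PowerSeries.coeff_derivative]
      cases n with
      | zero => simp [PowerSeries.coeff_X]
      | succ n =>
        rw [PowerSeries.coeff_succ_X_mul]
        simp [PowerSeries.coeff_X, PowerSeries.coeff_one, pow_succ]
    rw [h1]
    have h2 : (fun n => algebraMap ℚ ℚ (e n) * (-1) ^ n) = logDerS Q := by
      funext n
      have : ((-1 : ℚ) ^ n) * (-1) ^ n = 1 := by rw [← mul_pow]; simp
      simp only [e, Algebra.algebraMap_self, RingHom.id_apply]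
      linear_combination (logDerS Q n) * this
    rw [h2]
    symm
    rw [← expInt_iff Q hQ, mul_comm]
    exact ((mul_logDerS_iff Q hQ _).2 rfl).symm

/-! ### Uniqueness -/

theorem aeval_weighted {A : Type} [CommRing A] [Algebra ℚ A] {p : MvPolynomial ℕ+ ℚ} {k : ℕ}
    (hp : MvPolynomial.IsWeightedHomogeneous wt p k) (x : A) (y : ℕ+ → A) :
    MvPolynomial.aeval (fun j : ℕ+ => x ^ (j : ℕ) * y j) p = x ^ k * MvPolynomial.aeval y p := by
  rw [MvPolynomial.aeval_def, MvPolynomial.aeval_def, MvPolynomial.eval₂_eq, MvPolynomial.eval₂_eq,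
    Finset.mul_sum]
  refine Finset.sum_congr rfl fun d hd => ?_
  have hw : ∑ i ∈ d.support, (i : ℕ) * d i = k := by
    have := hp (MvPolynomial.mem_support_iff.1 hd)
    rw [Finsupp.weight_apply, Finsupp.sum] at this
    simpa [wt, mul_comm] using this
  simp only [mul_pow, ← pow_mul, Finset.prod_mul_distrib]
  rw [Finset.prod_pow_eq_pow_sum, hw]
  ring

theorem coeff_evalSeries_linear {K : ℕ → MvPolynomial ℕ+ ℚ} (hK : IsMultiplicativeSequence K)
    {A : Type} [CommRing A] [Algebra ℚ A] (x : A) (k : ℕ) :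
    PowerSeries.coeff k (evalSeries K (1 + PowerSeries.C x * PowerSeries.X)) =
      x ^ k * algebraMap ℚ A (PowerSeries.coeff k (charSeries K)) := by
  rw [charSeries, evalSeries, evalSeries, PowerSeries.coeff_mk, PowerSeries.coeff_mk,
    ← MvPolynomial.aeval_algebraMap_apply, ← aeval_weighted (hK.homogeneous k)]
  congr 2
  funext j
  have hj : (j : ℕ) ≠ 0 := j.ne_zero
  simp only [map_add, PowerSeries.coeff_one, hj, if_false, PowerSeries.coeff_C_mul,
    PowerSeries.coeff_X, Function.comp, zero_add]
  split_ifs with h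
  · simp [h]
  · simp

theorem constantCoeff_evalSeries {K : ℕ → MvPolynomial ℕ+ ℚ} (hK : IsMultiplicativeSequence K)
    {A : Type} [CommRing A] [Algebra ℚ A] (f : PowerSeries A) :
    PowerSeries.constantCoeff (evalSeries K f) = 1 := by
  rw [← PowerSeries.coeff_zero_eq_constantCoeff_apply, evalSeries, PowerSeries.coeff_mk, hK.zero,
    map_one]

theorem evalSeries_one {K : ℕ → MvPolynomial ℕ+ ℚ} (hK : IsMultiplicativeSequence K)
    {A : Type} [CommRing A] [Algebra ℚ A] : evalSeries K (1 : PowerSeries A) = 1 := by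
  have h := hK.mul A 1 1 (by simp) (by simp)
  have hu : IsUnit (evalSeries K (1 : PowerSeries A)) := by
    rw [PowerSeries.isUnit_iff_constantCoeff, constantCoeff_evalSeries hK]
    exact isUnit_one
  rw [mul_one] at h
  exact hu.mul_left_cancel (by rw [← h, mul_one])

theorem evalSeries_prod {K : ℕ → MvPolynomial ℕ+ ℚ} (hK : IsMultiplicativeSequence K)
    {A : Type} [CommRing A] [Algebra ℚ A] {ι : Type} (s : Finset ι) (f : ι → PowerSeries A)
    (hf : ∀ i, PowerSeries.constantCoeff (f i) = 1) :
    evalSeries K (∏ i ∈ s, f i) = ∏ i ∈ s, evalSeries K (f i) := by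
  classical
  induction s using Finset.induction_on with
  | empty => simpa using evalSeries_one hK
  | insert i s hi ih =>
    rw [Finset.prod_insert hi, Finset.prod_insert hi, hK.mul A _ _ (hf i) (by simp [hf]), ih]

theorem coeff_prod_linear (m n : ℕ) :
    PowerSeries.coeff n (∏ i : Fin m,
      (1 + PowerSeries.C (MvPolynomial.X i : MvPolynomial (Fin m) ℚ) * PowerSeries.X)) =
      MvPolynomial.esymm (Fin m) ℚ n := by
  rw [Finset.prod_one_add, map_sum, MvPolynomial.esymm, Finset.powersetCard_eq_filter,
    Finset.sum_filter]
  refine Finset.sum_congr rfl fun t _ => ?_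
  rw [Finset.prod_mul_distrib, Finset.prod_const, ← map_prod, PowerSeries.coeff_C_mul,
    PowerSeries.coeff_X_pow]
  simp [eq_comm]

theorem eq_of_charSeries_eq {K K' : ℕ → MvPolynomial ℕ+ ℚ} (hK : IsMultiplicativeSequence K)
    (hK' : IsMultiplicativeSequence K') (h : charSeries K = charSeries K') : K = K' := by
  funext k
  have hd : MvPolynomial.IsWeightedHomogeneous wt (K k - K' k) k :=
    (hK.homogeneous k).sub (hK'.homogeneous k)
  let ι : Fin k → ℕ+ := fun i => Nat.succPNat i
  have hι : Function.Injective ι := fun a b hab => Fin.ext (Nat.succPNat_injective hab)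
  obtain ⟨q, hq⟩ := MvPolynomial.exists_rename_eq_of_vars_subset_range (K k - K' k) ι hι (by
    intro j hj
    obtain ⟨d, hd1, hd2⟩ := (MvPolynomial.mem_vars_iff_mem_support j).1 (Finset.mem_coe.1 hj)
    have h1 := hd (MvPolynomial.mem_support_iff.1 hd1)
    have h2 : (j : ℕ) ≤ k := by
      rw [← h1]
      exact Finsupp.le_weight_of_ne_zero' wt (Finsupp.mem_support_iff.1 hd2)
    have h3 := j.pos
    exact ⟨⟨(j : ℕ) - 1, by omega⟩, PNat.eq (by simp [ι]; omega)⟩)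
  have hev : ∀ j : ℕ+ → MvPolynomial (Fin k) ℚ,
      (∀ i, j i = MvPolynomial.esymm (Fin k) ℚ i) → MvPolynomial.aeval j (K k - K' k) = 0 := by
    intro j hj
    obtain rfl : j = fun i : ℕ+ => PowerSeries.coeff (i : ℕ) (∏ i : Fin k,
      (1 + PowerSeries.C (MvPolynomial.X i : MvPolynomial (Fin k) ℚ) * PowerSeries.X)) := by
      funext i
      rw [hj, coeff_prod_linear]
    have hser : evalSeries K (∏ i : Fin k,
          (1 + PowerSeries.C (MvPolynomial.X i : MvPolynomial (Fin k) ℚ) * PowerSeries.X)) =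
        evalSeries K' (∏ i : Fin k,
          (1 + PowerSeries.C (MvPolynomial.X i : MvPolynomial (Fin k) ℚ) * PowerSeries.X)) := by
      rw [evalSeries_prod hK _ _ (by simp), evalSeries_prod hK' _ _ (by simp)]
      refine Finset.prod_congr rfl fun i _ => ?_
      ext1 n
      rw [coeff_evalSeries_linear hK, coeff_evalSeries_linear hK', h]
    have := congrArg (PowerSeries.coeff k) hser
    simp only [evalSeries, PowerSeries.coeff_mk] at this
    rw [map_sub, this, sub_self]
  have h0 := hev _ fun _ => rfl
  rw [← hq, MvPolynomial.aeval_rename] at h0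
  have hq0 : q = 0 := by
    apply MvPolynomial.esymmAlgHom_fin_injective (R := ℚ) (le_refl k)
    apply Subtype.ext
    rw [MvPolynomial.esymmAlgHom_apply, map_zero]
    exact h0
  rw [hq0, map_zero] at hq
  exact sub_eq_zero.1 hq.symm

/-- A multiplicative sequence is determined by its characteristic power series, which can be any
power series with constant term `1`. -/
theorem existsUnique_multiplicativeSequence (Q : PowerSeries ℚ)
    (hQ : PowerSeries.constantCoeff Q = 1) :
    ∃! K, IsMultiplicativeSequence K ∧ charSeries K = Q := by
  obtain ⟨K, hK, hKQ⟩ := exists_multiplicativeSequence Q hQ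
  exact ⟨K, ⟨hK, hKQ⟩, fun K' hK' => eq_of_charSeries_eq hK'.1 hK (hK'.2.trans hKQ.symm)⟩

/-! ### The Hirzebruch `L`-polynomials -/

/-- `cosh √z = ∑ zⁿ / (2n)!`. -/
noncomputable def coshSqrt : PowerSeries ℚ :=
  PowerSeries.mk fun n => 1 / ((2 * n).factorial : ℚ)

/-- `sinh √z / √z = ∑ zⁿ / (2n+1)!`. -/
noncomputable def sinhSqrtDivSqrt : PowerSeries ℚ :=
  PowerSeries.mk fun n => 1 / ((2 * n + 1).factorial : ℚ)

/-- `√z / tanh √z = cosh √z / (sinh √z / √z)`, as a formal power series in `z`. -/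
noncomputable def sqrtDivTanhSqrt : PowerSeries ℚ :=
  coshSqrt * sinhSqrtDivSqrt⁻¹

theorem constantCoeff_sqrtDivTanhSqrt : PowerSeries.constantCoeff sqrtDivTanhSqrt = 1 := by
  rw [sqrtDivTanhSqrt, map_mul, PowerSeries.constantCoeff_inv, coshSqrt, sinhSqrtDivSqrt]
  simp [← PowerSeries.coeff_zero_eq_constantCoeff_apply]

/-- The Hirzebruch `L`-polynomials `L_0, L_1, L_2, …`: the multiplicative sequence with
characteristic power series `√z / tanh √z`. -/
noncomputable def hirzebruchL : ℕ → MvPolynomial ℕ+ ℚ :=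
  (existsUnique_multiplicativeSequence sqrtDivTanhSqrt constantCoeff_sqrtDivTanhSqrt).choose

theorem hirzebruchL_spec :
    IsMultiplicativeSequence hirzebruchL ∧ charSeries hirzebruchL = sqrtDivTanhSqrt :=
  (existsUnique_multiplicativeSequence sqrtDivTanhSqrt
    constantCoeff_sqrtDivTanhSqrt).choose_spec.1

/-- The coefficient `h_{j₁,…,j_r}` of the monomial `p_{j₁} ⋯ p_{j_r}` in `L_k`. -/
noncomputable def hirzebruchCoeff (k : ℕ) {r : ℕ} (j : Fin r → ℕ+) : ℚ :=
  MvPolynomial.coeff (∑ i, Finsupp.single (j i) 1) (hirzebruchL k)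

/-- `α_l`, the number of indices `i` with `j_i = l`. -/
def alpha {r : ℕ} (j : Fin r → ℕ+) (l : ℕ) : ℕ :=
  (Finset.univ.filter fun i => (j i : ℕ) = l).card

/-! ### The alternating multiple zeta series -/

/-- `n ≥₂ m`: `n ≥ m`, with equality only if `n` is even. -/
def GeTwo (n m : ℕ) : Prop := m ≤ n ∧ (n = m → Even n)

/-- The indices `n₁ ≥₂ n₂ ≥₂ ⋯ ≥₂ n_r ≥ 1`. -/
def chains (r : ℕ) : Set (Fin r → ℕ) :=
  {n | (∀ i, 1 ≤ n i) ∧ ∀ i i' : Fin r, (i : ℕ) + 1 = i' → GeTwo (n i) (n i')}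

/-- The term `(-1)^{n₁ + ⋯ + n_r} / (n₁^{s₁} ⋯ n_r^{s_r})`. -/
noncomputable def altTerm {r : ℕ} (s : Fin r → ℝ) (n : Fin r → ℕ) : ℝ :=
  (-1) ^ (∑ i, n i) / ∏ i, (n i : ℝ) ^ s i

/-- The series `T(s₁, …, s_r)`. -/
noncomputable def T {r : ℕ} (s : Fin r → ℝ) : ℝ :=
  ∑' n : chains r, altTerm s n

/-- The symmetrization `T^Σ(s₁, …, s_r)`. -/
noncomputable def TSym {r : ℕ} (s : Fin r → ℝ) : ℝ :=
  ∑ σ : Equiv.Perm (Fin r), T fun i => s (σ i)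

end Hirz

namespace Hirz

/-! ### The Hirzebruch polynomials as Hadamard products of logarithms -/

/-! The mechanism is the product expansion of the characteristic series. With $x_v=(2/(\pi v))^2$,
the Euler products of $\cosh$ and $\sinh$ give $\sqrt z/\tanh\sqrt
z=\prod_{v\ge1}(1+x_vz)^{\epsilon_v}$, where $\epsilon_v=-(-1)^v$. By multiplicativity,
$\sum_k\mathsf L_k z^k=\prod_v f(x_vz)^{\epsilon_v}$ for the generic series $f=1+\mathsf
p_1z+\mathsf p_2z^2+\cdots$. An odd $v$ contributes $f(x_vz)$, from which at most one variable is
taken. An even $v$ contributes $1/f(x_vz)=\sum_m(1-f(x_vz))^m$, from which any number may be taken,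
each with sign $-1$. Recording which $v$ each variable comes from, in decreasing order, produces
exactly the chains for $\ge_2$. Summing over all orderings of $(j_1,\ldots,j_r)$ counts each
assignment $\alpha_1!\cdots\alpha_k!$ times.

Infinite products are avoided by working with logarithmic derivatives. On these a multiplicative
sequence acts by termwise multiplication with a fixed sequence $e$ (`hirzebruchL_eq_expInt`). The
resulting series `hadamardExp e` turns sums in $e$ into products and sends $e_n=x^{n+1}$ to $f(xz)$.
Thus the product truncated at $N$ corresponds to a signed power sum, and its coefficients are the
truncated symmetrized sums (`symChainSum_eq_scaledCoeff`). Each coefficient is continuous in $e$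
(`tendsto_coeff_hadamardExp`), so it remains to find the limits of the power sums
(`tendsto_altPowerSum_root`). These come from the Fourier series of the Bernoulli polynomials at
$1/2$ and a formal computation of the logarithmic derivative of $\sqrt z/\tanh\sqrt z$. -/

/-- The explicit sequence is multiplicative with the right characteristic series, so uniqueness
identifies it with `hirzebruchL`. The sign $(-1)^n$ compensates the logarithmic derivative
$\sum(-1)^nz^n$ of $1+z$. -/
theorem hirzebruchL_eq_expInt (k : ℕ) : hirzebruchL k =
    expInt (fun n => MvPolynomial.C ((-1) ^ n * logDerS sqrtDivTanhSqrt n) *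
      logDer universalCoeff n) k := by
  let e : ℕ → ℚ := fun n => (-1) ^ n * logDerS sqrtDivTanhSqrt n
  let K : ℕ → MvPolynomial ℕ+ ℚ :=
    expInt fun n => MvPolynomial.C (e n) * logDer universalCoeff n
  have hK : ∀ (A : Type) [CommRing A] [Algebra ℚ A] (f : PowerSeries A),
      PowerSeries.constantCoeff f = 1 → evalSeries K f =
        PowerSeries.mk (expInt fun n => algebraMap ℚ A (e n) * logDerS f n) := by
    intro A _ _ f hf
    ext k
    simp only [evalSeries, PowerSeries.coeff_mk, K]
    rw [map_expInt]
    congr 1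
    funext n
    have h := map_logDer (MvPolynomial.aeval (R := ℚ)
      (fun j : ℕ+ => PowerSeries.coeff (j : ℕ) f)).toRingHom universalCoeff n
    simp only [AlgHom.toRingHom_eq_coe, RingHom.coe_coe] at h
    rw [map_mul, MvPolynomial.algHom_C, h, logDerS]
    congr 2
    funext m
    unfold universalCoeff
    split_ifs with hm
    · rw [MvPolynomial.aeval_X]; rfl
    · obtain rfl : m = 0 := by omega
      simp [hf]
  have hmul : IsMultiplicativeSequence K := by
    refine ⟨by simp [K, expInt], fun k => ?_, ?_⟩
    · exact expInt_homogeneous _ (fun n => (logDer_homogeneous n).C_mul _) k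
    · intro A _ _ f g hf hg
      rw [hK A _ (by simp [hf, hg]), hK A f hf, hK A g hg, ← mk_expInt_add, logDerS_mul f g hf hg]
      congr 2
      funext n
      simp [mul_add]
  have hchar : charSeries K = sqrtDivTanhSqrt := by
    rw [charSeries, hK ℚ _ (by simp)]
    have h1 : logDerS (1 + PowerSeries.X : PowerSeries ℚ) = fun n => (-1) ^ n := by
      symm
      rw [← mul_logDerS_iff _ (by simp)]
      ext n
      rw [add_mul, one_mul, map_add, PowerSeries.coeff_derivative]
      cases n with
      | zero => simp [PowerSeries.coeff_X]
      | succ n =>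
        rw [PowerSeries.coeff_succ_X_mul]
        simp [PowerSeries.coeff_X, PowerSeries.coeff_one, pow_succ]
    have h2 : (fun n => algebraMap ℚ ℚ (e n) * (-1) ^ n) = logDerS sqrtDivTanhSqrt := by
      funext n
      have : ((-1 : ℚ) ^ n) * (-1) ^ n = 1 := by rw [← mul_pow]; simp
      simp only [e, Algebra.algebraMap_self, RingHom.id_apply]
      linear_combination (logDerS sqrtDivTanhSqrt n) * this
    rw [h1, h2]
    symm
    rw [← expInt_iff _ constantCoeff_sqrtDivTanhSqrt, mul_comm]
    exact ((mul_logDerS_iff _ constantCoeff_sqrtDivTanhSqrt _).2 rfl).symm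
  exact congrFun (eq_of_charSeries_eq hirzebruchL_spec.1 hmul
    (hirzebruchL_spec.2.trans hchar.symm)) k

/-- The power series `1 + p₁ z + p₂ z² + ⋯` with real coefficients. -/
noncomputable def genericSeries : PowerSeries (MvPolynomial ℕ+ ℝ) :=
  PowerSeries.mk fun n => MvPolynomial.map (algebraMap ℚ ℝ) (universalCoeff n)

/-- The power series whose logarithmic derivative is the termwise product of `e` with the
logarithmic derivative of `1 + p₁ z + p₂ z² + ⋯`. -/
noncomputable def hadamardExp (e : ℕ → ℝ) : PowerSeries (MvPolynomial ℕ+ ℝ) :=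
  PowerSeries.mk (expInt fun n => MvPolynomial.C (e n) * logDerS genericSeries n)

theorem map_hirzebruchL (k : ℕ) : MvPolynomial.map (algebraMap ℚ ℝ) (hirzebruchL k) =
    PowerSeries.coeff k
      (hadamardExp fun n => (((-1) ^ n * logDerS sqrtDivTanhSqrt n : ℚ) : ℝ)) := by
  have h := map_expInt (MvPolynomial.mapAlgHom (σ := ℕ+) (Algebra.ofId ℚ ℝ))
    (fun n => MvPolynomial.C ((-1) ^ n * logDerS sqrtDivTanhSqrt n) * logDer universalCoeff n) k
  have h' : ∀ p : MvPolynomial ℕ+ ℚ, MvPolynomial.mapAlgHom (Algebra.ofId ℚ ℝ) p =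
      MvPolynomial.map (algebraMap ℚ ℝ) p := fun p => rfl
  rw [h', ← hirzebruchL_eq_expInt] at h
  rw [h, hadamardExp, PowerSeries.coeff_mk]
  congr 1
  funext n
  have hl : logDerS genericSeries n =
      logDer (fun m => MvPolynomial.map (algebraMap ℚ ℝ) (universalCoeff m)) n := by
    simp only [logDerS, genericSeries, PowerSeries.coeff_mk]
  rw [h', map_mul, map_logDer, MvPolynomial.map_C, hl]
  rfl

theorem constantCoeff_genericSeries : PowerSeries.constantCoeff genericSeries = 1 := by
  rw [← PowerSeries.coeff_zero_eq_constantCoeff_apply, genericSeries, PowerSeries.coeff_mk]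
  simp [universalCoeff]

theorem coeff_succ_genericSeries (n : ℕ) :
    PowerSeries.coeff (n + 1) genericSeries = MvPolynomial.X n.succPNat := by
  rw [genericSeries, PowerSeries.coeff_mk, universalCoeff, dif_pos n.succ_pos, MvPolynomial.map_X]
  rfl

theorem hadamardExp_add (e e' : ℕ → ℝ) :
    hadamardExp (e + e') = hadamardExp e * hadamardExp e' := by
  rw [hadamardExp, hadamardExp, hadamardExp, ← mk_expInt_add]
  congr 2
  funext n
  simp [add_mul]

theorem hadamardExp_zero : hadamardExp 0 = 1 := by
  symm
  rw [hadamardExp, ← expInt_iff _ (by simp)]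
  ext n
  simp

/-- The chain rule multiplies the $n$-th coefficient of the logarithmic derivative by $x^{n+1}$ when
$z$ is replaced by $xz$. -/
theorem hadamardExp_pow (x : ℝ) : hadamardExp (fun n => x ^ (n + 1)) =
    PowerSeries.rescale (MvPolynomial.C x) genericSeries := by
  have h0 : PowerSeries.constantCoeff
      (PowerSeries.rescale (MvPolynomial.C x) genericSeries) = 1 := by
    rw [← PowerSeries.coeff_zero_eq_constantCoeff_apply, PowerSeries.coeff_rescale]
    simp [constantCoeff_genericSeries]
  symm
  rw [hadamardExp, ← expInt_iff _ h0]
  have h1 := congrArg (PowerSeries.rescale (MvPolynomial.C x))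
    ((mul_logDerS_iff genericSeries constantCoeff_genericSeries _).2 rfl)
  have h2 : PowerSeries.derivative _ (PowerSeries.rescale (MvPolynomial.C x) genericSeries) =
      PowerSeries.C (MvPolynomial.C x) * PowerSeries.rescale (MvPolynomial.C x)
        (PowerSeries.derivative _ genericSeries) := by
    ext1 n
    rw [PowerSeries.coeff_derivative, PowerSeries.coeff_rescale, PowerSeries.coeff_C_mul,
      PowerSeries.coeff_rescale, PowerSeries.coeff_derivative]
    ring
  have h3 : PowerSeries.mk (fun n => MvPolynomial.C (x ^ (n + 1)) * logDerS genericSeries n) =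
      PowerSeries.C (MvPolynomial.C x) * PowerSeries.rescale (MvPolynomial.C x)
        (PowerSeries.mk (logDerS genericSeries)) := by
    ext1 n
    rw [PowerSeries.coeff_mk, PowerSeries.coeff_C_mul,
      PowerSeries.coeff_rescale, PowerSeries.coeff_mk, map_pow]
    ring
  rw [h2, h3, ← h1, map_mul]
  ring

/-- Every coefficient of $f(xz)$ beyond the constant term is a single variable $x^j\mathsf p_j$, so
the factor removes at most one variable from the monomial. -/
theorem coeff_coeff_mul_rescale (G : PowerSeries (MvPolynomial ℕ+ ℝ)) (x : ℝ) (d : ℕ+ →₀ ℕ)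
    {k : ℕ} (hd : Finsupp.weight wt d = k) :
    MvPolynomial.coeff d (PowerSeries.coeff k
      (G * PowerSeries.rescale (MvPolynomial.C x) genericSeries)) =
    MvPolynomial.coeff d (PowerSeries.coeff k G) + ∑ j ∈ d.support, x ^ (j : ℕ) *
      MvPolynomial.coeff (d - Finsupp.single j 1) (PowerSeries.coeff (k - j) G) := by
  classical
  -- Extended by zero off the support, the sum can run over all $j\le k$, matching the Cauchy
  -- product.
  let F : ℕ+ → ℝ := fun j => if j ∈ d.support then x ^ (j : ℕ) *
    MvPolynomial.coeff (d - Finsupp.single j 1) (PowerSeries.coeff (k - j) G) else 0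
  have hF : ∑ j ∈ d.support, x ^ (j : ℕ) *
      MvPolynomial.coeff (d - Finsupp.single j 1) (PowerSeries.coeff (k - j) G) =
      ∑ m ∈ Finset.range k, F m.succPNat := by
    rw [← Finset.sum_image (f := F) (g := Nat.succPNat)
      (fun a _ b _ h => Nat.succPNat_injective h)]
    have hs : d.support ⊆ (Finset.range k).image Nat.succPNat := by
      intro j hj
      have h2 : (j : ℕ) ≤ k := by
        rw [← hd]
        exact Finsupp.le_weight_of_ne_zero' wt (Finsupp.mem_support_iff.1 hj)
      have h3 := j.pos
      exact Finset.mem_image.2 ⟨(j : ℕ) - 1, Finset.mem_range.2 (by omega),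
        PNat.eq (by simp; omega)⟩
    rw [← Finset.sum_subset hs fun j _ hj => if_neg hj]
    exact Finset.sum_congr rfl fun j hj => (if_pos hj).symm
  rw [hF, mul_comm, PowerSeries.coeff_mul, Finset.Nat.sum_antidiagonal_eq_sum_range_succ_mk,
    Finset.sum_range_succ', MvPolynomial.coeff_add, MvPolynomial.coeff_sum, add_comm]
  congr 1
  · simp [constantCoeff_genericSeries]
  · refine Finset.sum_congr rfl fun m _ => ?_
    rw [PowerSeries.coeff_rescale, coeff_succ_genericSeries, ← map_pow, mul_assoc,
      MvPolynomial.coeff_C_mul, mul_comm (MvPolynomial.X _), MvPolynomial.coeff_mul_X']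
    simp only [F, Nat.succPNat_coe, Nat.succ_eq_add_one, mul_ite, mul_zero]

/-- A fixed coefficient involves only finitely many $e_n$, and polynomially; the recursion for
`expInt` gives this by induction on the degree. -/
theorem tendsto_coeff_hadamardExp {e : ℕ → ℕ → ℝ} {e' : ℕ → ℝ}
    (h : ∀ n, Filter.Tendsto (fun N => e N n) Filter.atTop (nhds (e' n))) (k : ℕ)
    (d : ℕ+ →₀ ℕ) :
    Filter.Tendsto
      (fun N => MvPolynomial.coeff d (PowerSeries.coeff k (hadamardExp (e N)))) Filter.atTop
      (nhds (MvPolynomial.coeff d (PowerSeries.coeff k (hadamardExp e')))) := by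
  simp only [hadamardExp, PowerSeries.coeff_mk]
  induction k using Nat.strong_induction_on generalizing d with
  | _ k ih =>
    cases k with
    | zero => simp only [expInt]; exact tendsto_const_nhds
    | succ k =>
      have key : ∀ c : ℕ → MvPolynomial ℕ+ ℝ, MvPolynomial.coeff d (expInt c (k + 1)) =
          algebraMap ℚ ℝ (1 / (k + 1)) * ∑ i ∈ Finset.range (k + 1),
            ∑ p ∈ Finset.HasAntidiagonal.antidiagonal d,
              MvPolynomial.coeff p.1 (c (k - i)) * MvPolynomial.coeff p.2 (expInt c i) := by
        intro c
        rw [expInt_succ, IsScalarTower.algebraMap_apply ℚ ℝ (MvPolynomial ℕ+ ℝ),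
          MvPolynomial.algebraMap_eq, MvPolynomial.coeff_C_mul, MvPolynomial.coeff_sum]
        simp only [MvPolynomial.coeff_mul]
      simp only [key, MvPolynomial.coeff_C_mul]
      refine Filter.Tendsto.const_mul _ (tendsto_finsetSum _ fun i hi =>
        tendsto_finsetSum _ fun p _ => ?_)
      exact ((h _).mul_const _).mul (ih i (Finset.mem_range.1 hi) _)


/-! ### Truncated chain sums -/

theorem antitone_of_mem_chains {r : ℕ} {n : Fin r → ℕ} (hn : n ∈ chains r) : Antitone n := by
  cases r with
  | zero => exact fun i => i.elim0
  | succ r =>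
    rw [Fin.antitone_iff_succ_le]
    exact fun i => (hn.2 i.castSucc i.succ (by simp)).1

theorem cons_mem_chains {r : ℕ} {a : ℕ} {n : Fin r → ℕ} :
    (Fin.cons a n : Fin (r + 1) → ℕ) ∈ chains (r + 1) ↔
      1 ≤ a ∧ n ∈ chains r ∧ ∀ i, if Even a then n i ≤ a else n i < a := by
  have key : ∀ m : ℕ, GeTwo a m ↔ if Even a then m ≤ a else m < a := fun m => by
    unfold GeTwo
    split_ifs with h
    · simp [h]
    · simp only [h, imp_false]; omega
  constructor
  · intro h
    have hn : n ∈ chains r := ⟨fun i => by simpa using h.1 i.succ, fun i i' hi => by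
      simpa using h.2 i.succ i'.succ (by simp [hi])⟩
    refine ⟨by simpa using h.1 0, hn, fun i => ?_⟩
    cases r with
    | zero => exact i.elim0
    | succ r =>
      have h0 := (key _).1 (by simpa using h.2 0 (Fin.succ 0) (by simp))
      have hi := antitone_of_mem_chains hn (Fin.zero_le i)
      split_ifs at h0 ⊢ <;> omega
  · rintro ⟨ha, hn, hle⟩
    refine ⟨fun i => ?_, fun i i' hi => ?_⟩
    · cases i using Fin.cases with
      | zero => simpa using ha
      | succ i => simpa using hn.1 i
    · cases i' using Fin.cases with
      | zero => simp at hi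
      | succ i' =>
        cases i using Fin.cases with
        | zero => simpa using (key _).2 (hle i')
        | succ i => simpa using hn.2 i i' (by simpa using hi)

open Classical in
/-- The chains with entries at most `N`. -/
noncomputable def boundedChains (r N : ℕ) : Finset (Fin r → ℕ) :=
  (Fintype.piFinset fun _ => Finset.range (N + 1)).filter (· ∈ chains r)

theorem mem_boundedChains {r N : ℕ} {n : Fin r → ℕ} :
    n ∈ boundedChains r N ↔ n ∈ chains r ∧ ∀ i, n i ≤ N := by
  simp [boundedChains, Fintype.mem_piFinset, and_comm]

/-- A new chain starts with $N+1$. Its tail may repeat $N+1$ only if this is even, hence the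
parity-dependent bound. -/
theorem boundedChains_succ (r N : ℕ) : boundedChains (r + 1) (N + 1) =
    boundedChains (r + 1) N ∪ (boundedChains r (if Even (N + 1) then N + 1 else N)).map
      ⟨fun n => Fin.cons (N + 1) n, Fin.cons_right_injective (α := fun _ => ℕ) _⟩ := by
  ext n
  simp only [Finset.mem_union, Finset.mem_map, Function.Embedding.coeFn_mk, mem_boundedChains]
  constructor
  · rintro ⟨hn, hle⟩
    by_cases h : n 0 ≤ N
    · exact Or.inl ⟨hn, fun i => (antitone_of_mem_chains hn (Fin.zero_le i)).trans h⟩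
    · have h0 : n 0 = N + 1 := by have := hle 0; omega
      have hc : Fin.cons (N + 1) (Fin.tail n) = n := by rw [← h0, Fin.cons_self_tail]
      refine Or.inr ⟨Fin.tail n, ?_, hc⟩
      rw [← hc, cons_mem_chains] at hn
      refine ⟨hn.2.1, fun i => ?_⟩
      have := hn.2.2 i
      split_ifs at this ⊢ <;> omega
  · rintro (⟨hn, hle⟩ | ⟨m, ⟨hm, hle⟩, rfl⟩)
    · exact ⟨hn, fun i => (hle i).trans N.le_succ⟩
    · refine ⟨cons_mem_chains.2 ⟨by omega, hm, fun i => ?_⟩, fun i => ?_⟩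
      · have := hle i
        split_ifs at this ⊢ <;> omega
      · cases i using Fin.cases with
        | zero => simp
        | succ i =>
          have := hle i
          simp only [Fin.cons_succ]
          split_ifs at this <;> omega

/-- The sum of `∏ -(-1)^{n_i} x_{n_i}^{j_i}` over the chains `n` with entries at most `N`. -/
noncomputable def chainSum (x : ℕ → ℝ) (N : ℕ) {r : ℕ} (j : Fin r → ℕ+) : ℝ :=
  ∑ n ∈ boundedChains r N, ∏ i, (-(-1) ^ n i * x (n i) ^ (j i : ℕ))

theorem chainSum_succ (x : ℕ → ℝ) (N : ℕ) {r : ℕ} (j : Fin (r + 1) → ℕ+) :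
    chainSum x (N + 1) j = chainSum x N j + -(-1) ^ (N + 1) * x (N + 1) ^ (j 0 : ℕ) *
      chainSum x (if Even (N + 1) then N + 1 else N) (fun i => j i.succ) := by
  rw [chainSum, boundedChains_succ, Finset.sum_union, Finset.sum_map, chainSum, chainSum,
    Finset.mul_sum]
  · congr 1
    refine Finset.sum_congr rfl fun n _ => ?_
    simp [Fin.prod_univ_succ]
  · rw [Finset.disjoint_left]
    intro n hn hn'
    obtain ⟨m, _, rfl⟩ := Finset.mem_map.1 hn'
    have := (mem_boundedChains.1 hn).2 0
    simp at this

theorem chainSum_zero (x : ℕ → ℝ) {r : ℕ} (j : Fin (r + 1) → ℕ+) : chainSum x 0 j = 0 := by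
  rw [chainSum]
  refine Finset.sum_eq_zero fun n hn => ?_
  have h := mem_boundedChains.1 hn
  have h1 := h.1.1 0
  have h2 := h.2 0
  omega

theorem chainSum_nil (x : ℕ → ℝ) (N : ℕ) (j : Fin 0 → ℕ+) : chainSum x N j = 1 := by
  have : boundedChains 0 N = {Fin.elim0} := by
    ext n
    rw [mem_boundedChains, Finset.mem_singleton]
    refine ⟨fun _ => Subsingleton.elim _ _, fun _ => ⟨⟨fun i => i.elim0, fun i => i.elim0⟩,
      fun i => i.elim0⟩⟩
  rw [chainSum, this]
  simp

/-- The symmetrization of `chainSum`. -/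
noncomputable def symChainSum (x : ℕ → ℝ) (N : ℕ) {r : ℕ} (j : Fin r → ℕ+) : ℝ :=
  ∑ σ : Equiv.Perm (Fin r), chainSum x N fun i => j (σ i)

/-- Moves the entry at `p` to the front and deletes it. -/
def deleteAt {α : Type*} {r : ℕ} (j : Fin (r + 1) → α) (p : Fin (r + 1)) (i : Fin r) : α :=
  j (Equiv.swap 0 p i.succ)

/-- A permutation amounts to the choice of the position $p$ that goes first and a permutation of
what is left. -/
theorem symChainSum_succ (x : ℕ → ℝ) (N : ℕ) {r : ℕ} (j : Fin (r + 1) → ℕ+) :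
    symChainSum x (N + 1) j = symChainSum x N j + ∑ p, -(-1) ^ (N + 1) *
      x (N + 1) ^ (j p : ℕ) * symChainSum x (if Even (N + 1) then N + 1 else N)
        (deleteAt j p) := by
  simp only [symChainSum, chainSum_succ x N, Finset.sum_add_distrib]
  congr 1
  rw [← Equiv.sum_comp (Equiv.Perm.decomposeFin (n := r)).symm, Fintype.sum_prod_type]
  refine Finset.sum_congr rfl fun p _ => ?_
  rw [Finset.mul_sum]
  refine Finset.sum_congr rfl fun e _ => ?_
  simp only [Equiv.Perm.decomposeFin_symm_apply_zero, Equiv.Perm.decomposeFin_symm_apply_succ,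
    deleteAt]

/-! ### Coefficients of monomials and symmetrized chain sums -/

/-- The exponent of the monomial `p_{j₁} ⋯ p_{j_r}`. -/
noncomputable def exponent {r : ℕ} (j : Fin r → ℕ+) : ℕ+ →₀ ℕ :=
  ∑ i, Finsupp.single (j i) 1

theorem sum_eq_add_sum_deleteAt {M : Type*} [AddCommMonoid M] {α : Type*} {r : ℕ}
    (f : α → M) (j : Fin (r + 1) → α) (p : Fin (r + 1)) :
    ∑ i, f (j i) = f (j p) + ∑ i, f (deleteAt j p i) := by
  rw [← Equiv.sum_comp (Equiv.swap 0 p), Fin.sum_univ_succ, Equiv.swap_apply_left]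
  rfl

theorem exponent_deleteAt {r : ℕ} (j : Fin (r + 1) → ℕ+) (p : Fin (r + 1)) :
    exponent (deleteAt j p) = exponent j - Finsupp.single (j p) 1 := by
  rw [exponent, exponent, sum_eq_add_sum_deleteAt (fun a => Finsupp.single a 1) j p,
    add_tsub_cancel_left]

theorem weight_exponent {r : ℕ} (j : Fin r → ℕ+) :
    Finsupp.weight wt (exponent j) = ∑ i, (j i : ℕ) := by
  rw [exponent, map_sum]
  simp [Finsupp.weight_single, wt]

theorem exponent_apply {r : ℕ} (j : Fin r → ℕ+) (l : ℕ+) :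
    exponent j l = (Finset.univ.filter fun i => j i = l).card := by
  classical
  rw [exponent, Finsupp.finsetSum_apply, Finset.card_filter]
  exact Finset.sum_congr rfl fun i _ => by rw [Finsupp.single_apply]

theorem support_exponent {r : ℕ} (j : Fin r → ℕ+) :
    (exponent j).support = Finset.univ.image j := by
  ext l
  rw [Finsupp.mem_support_iff, exponent_apply]
  simp [Finset.card_eq_zero, Finset.filter_eq_empty_iff]

/-- The product of the factorials of the entries. -/
noncomputable def factorialProd (d : ℕ+ →₀ ℕ) : ℝ := d.prod fun _ m => (m.factorial : ℝ)

theorem factorialProd_eq_mul (d : ℕ+ →₀ ℕ) {l : ℕ+} (hl : l ∈ d.support) :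
    factorialProd d = d l * factorialProd (d - Finsupp.single l 1) := by
  classical
  have h : ∀ d' : ℕ+ →₀ ℕ, d'.support ⊆ d.support →
      factorialProd d' = ∏ a ∈ d.support, ((d' a).factorial : ℝ) := fun d' hd' =>
    Finsupp.prod_of_support_subset _ hd' _ (by simp)
  obtain ⟨d', hd'⟩ : ∃ d', d' = d - Finsupp.single l 1 := ⟨_, rfl⟩
  have hs : d'.support ⊆ d.support := hd' ▸ Finsupp.support_tsub
  rw [← hd', h d subset_rfl, h d' hs,
    ← Finset.mul_prod_erase _ (fun a => ((d a).factorial : ℝ)) hl,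
    ← Finset.mul_prod_erase _ (fun a => ((d' a).factorial : ℝ)) hl, ← mul_assoc]
  congr 1
  · have := Nat.pos_of_ne_zero (Finsupp.mem_support_iff.1 hl)
    rw [hd', Finsupp.tsub_apply, Finsupp.single_eq_same, ← Nat.cast_mul,
      Nat.mul_factorial_pred (by omega)]
  · refine Finset.prod_congr rfl fun a ha => ?_
    rw [hd', Finsupp.tsub_apply, Finsupp.single_eq_of_ne (Finset.ne_of_mem_erase ha), tsub_zero]

/-- `factorialProd` times the coefficient of `p_{j₁} ⋯ p_{j_r}` in degree `j₁ + ⋯ + j_r`. -/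
noncomputable def scaledCoeff (G : PowerSeries (MvPolynomial ℕ+ ℝ)) {r : ℕ} (j : Fin r → ℕ+) : ℝ :=
  factorialProd (exponent j) *
    MvPolynomial.coeff (exponent j) (PowerSeries.coeff (∑ i, (j i : ℕ)) G)

/-- The factorials turn the sum over distinct variables into one over positions: a variable of
multiplicity $m$ occupies $m$ positions, and $m!=m\,(m-1)!$. The result has the shape of
`symChainSum_succ`. -/
theorem scaledCoeff_mul_rescale (G : PowerSeries (MvPolynomial ℕ+ ℝ)) (x : ℝ) {r : ℕ}
    (j : Fin (r + 1) → ℕ+) :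
    scaledCoeff (G * PowerSeries.rescale (MvPolynomial.C x) genericSeries) j =
      scaledCoeff G j + ∑ p, x ^ (j p : ℕ) * scaledCoeff G (deleteAt j p) := by
  rw [scaledCoeff, coeff_coeff_mul_rescale _ _ _ (weight_exponent j), mul_add, scaledCoeff]
  congr 1
  let F : ℕ+ → ℝ := fun l => x ^ (l : ℕ) * (factorialProd (exponent j - Finsupp.single l 1) *
    MvPolynomial.coeff (exponent j - Finsupp.single l 1)
      (PowerSeries.coeff (∑ i, (j i : ℕ) - l) G))
  have h : ∑ p, x ^ (j p : ℕ) * scaledCoeff G (deleteAt j p) = ∑ p, F (j p) :=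
    Finset.sum_congr rfl fun p _ => by
      simp only [scaledCoeff, exponent_deleteAt, F]
      rw [sum_eq_add_sum_deleteAt (fun a : ℕ+ => (a : ℕ)) j p, add_tsub_cancel_left]
  rw [h, Finset.sum_comp F j, support_exponent, Finset.mul_sum]
  refine Finset.sum_congr rfl fun l hl => ?_
  rw [← exponent_apply, factorialProd_eq_mul _ (by rwa [support_exponent]), nsmul_eq_mul]
  simp only [F]
  ring

/-- The coefficients `∑ -(-1)^v x_v^{n+1}` over `1 ≤ v ≤ N`. -/
noncomputable def altPowerSum (x : ℕ → ℝ) (N n : ℕ) : ℝ :=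
  ∑ v ∈ Finset.range N, -(-1) ^ (v + 1) * x (v + 1) ^ (n + 1)

theorem scaledCoeff_nil (e : ℕ → ℝ) (j : Fin 0 → ℕ+) : scaledCoeff (hadamardExp e) j = 1 := by
  simp [scaledCoeff, hadamardExp, expInt, exponent, factorialProd]

theorem symChainSum_nil (x : ℕ → ℝ) (N : ℕ) (j : Fin 0 → ℕ+) : symChainSum x N j = 1 := by
  simp [symChainSum, chainSum_nil]

/-- Both sides obey the same recursion in $N$: an odd index multiplies the series by $f(x_{N+1}z)$,
an even one divides by it. -/
theorem symChainSum_eq_scaledCoeff (x : ℕ → ℝ) (N : ℕ) {r : ℕ} (j : Fin r → ℕ+) :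
    symChainSum x N j = scaledCoeff (hadamardExp (altPowerSum x N)) j := by
  induction N generalizing r with
  | zero =>
    have h0 : altPowerSum x 0 = 0 := by funext n; simp [altPowerSum]
    cases r with
    | zero => rw [symChainSum_nil, scaledCoeff_nil]
    | succ r =>
      have hk : ∑ i, (j i : ℕ) ≠ 0 := by
        rw [Fin.sum_univ_succ]
        have := (j 0).pos
        omega
      rw [symChainSum, Finset.sum_eq_zero fun σ _ => chainSum_zero x _, scaledCoeff, h0,
        hadamardExp_zero, PowerSeries.coeff_one, if_neg hk]
      simp
  | succ N ihN =>
    by_cases hN : Even (N + 1)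
    · have hG : hadamardExp (altPowerSum x N) = hadamardExp (altPowerSum x (N + 1)) *
          PowerSeries.rescale (MvPolynomial.C (x (N + 1))) genericSeries := by
        rw [← hadamardExp_pow, ← hadamardExp_add]
        congr 1
        funext n
        simp [altPowerSum, Finset.sum_range_succ, hN.neg_one_pow]
      -- For even $N+1$ the shorter sums in the recursion also have bound $N+1$, so induction on $N$
      -- alone is not enough.
      induction r with
      | zero => rw [symChainSum_nil, scaledCoeff_nil]
      | succ r ihr =>
        rw [symChainSum_succ, ihN, hG, scaledCoeff_mul_rescale]
        simp only [if_pos hN, ihr, hN.neg_one_pow, neg_mul, one_mul, Finset.sum_neg_distrib]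
        ring
    · have hG : hadamardExp (altPowerSum x (N + 1)) = hadamardExp (altPowerSum x N) *
          PowerSeries.rescale (MvPolynomial.C (x (N + 1))) genericSeries := by
        rw [← hadamardExp_pow, ← hadamardExp_add]
        congr 1
        funext n
        simp [altPowerSum, Finset.sum_range_succ, (Nat.not_even_iff_odd.1 hN).neg_one_pow, add_comm]
      cases r with
      | zero => rw [symChainSum_nil, scaledCoeff_nil]
      | succ r =>
        rw [symChainSum_succ, ihN, hG, scaledCoeff_mul_rescale]
        simp only [if_neg hN, ihN, (Nat.not_even_iff_odd.1 hN).neg_one_pow, neg_neg, one_mul]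

theorem factorialProd_exponent {r : ℕ} (j : Fin r → ℕ+) {k : ℕ} (hk : ∀ i, (j i : ℕ) ≤ k) :
    factorialProd (exponent j) = ∏ l ∈ Finset.Icc 1 k, ((alpha j l).factorial : ℝ) := by
  classical
  have hs : (exponent j).support ⊆ (Finset.range k).image Nat.succPNat := by
    rw [support_exponent]
    intro l hl
    obtain ⟨i, -, rfl⟩ := Finset.mem_image.1 hl
    have h1 := hk i
    have h2 := (j i).pos
    exact Finset.mem_image.2 ⟨(j i : ℕ) - 1, Finset.mem_range.2 (by omega),
      PNat.eq (by simp; omega)⟩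
  rw [factorialProd, Finsupp.prod_of_support_subset _ hs _ (by simp),
    Finset.prod_image (fun a _ b _ h => Nat.succPNat_injective h), Finset.range_eq_Ico,
    ← Finset.Ico_add_one_right_eq_Icc, Finset.prod_Ico_eq_prod_range, Finset.prod_Ico_eq_prod_range]
  refine Finset.prod_congr rfl fun m _ => ?_
  rw [exponent_apply, alpha]
  congr 3
  ext i
  simp only [Finset.mem_filter, ← PNat.coe_inj, Nat.succPNat_coe]
  simp [add_comm]


/-! ### The logarithmic derivative of `√z / tanh √z` -/

open PowerSeries in
theorem two_mul_derivative_coshSqrt : 2 * derivative ℚ coshSqrt = sinhSqrtDivSqrt := by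
  ext n
  rw [show (2 : PowerSeries ℚ) = C 2 from (map_ofNat C 2).symm, coeff_C_mul, coeff_derivative, coshSqrt,
    sinhSqrtDivSqrt, coeff_mk, coeff_mk, show 2 * (n + 1) = (2 * n + 1) + 1 by ring,
    Nat.factorial_succ (2 * n + 1)]
  push_cast
  field_simp
  ring

open PowerSeries in
theorem two_mul_X_mul_derivative_sinhSqrtDivSqrt :
    2 * X * derivative ℚ sinhSqrtDivSqrt = coshSqrt - sinhSqrtDivSqrt := by
  ext n
  rw [show (2 : PowerSeries ℚ) = C 2 from (map_ofNat C 2).symm, mul_assoc, coeff_C_mul, map_sub, coshSqrt,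
    sinhSqrtDivSqrt, coeff_mk, coeff_mk]
  cases n with
  | zero => simp
  | succ n =>
    rw [coeff_succ_X_mul, coeff_derivative, coeff_mk, Nat.factorial_succ (2 * (n + 1))]
    push_cast
    field_simp
    ring

open PowerSeries in
theorem constantCoeff_coshSqrt : constantCoeff coshSqrt = 1 := by
  simp [coshSqrt, ← coeff_zero_eq_constantCoeff_apply]

open PowerSeries in
theorem constantCoeff_sinhSqrtDivSqrt : constantCoeff sinhSqrtDivSqrt = 1 := by
  simp [sinhSqrtDivSqrt, ← coeff_zero_eq_constantCoeff_apply]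

open PowerSeries in
theorem coshSqrt_sq_sub : coshSqrt ^ 2 - X * sinhSqrtDivSqrt ^ 2 = 1 := by
  have hc := two_mul_derivative_coshSqrt
  have hs := two_mul_X_mul_derivative_sinhSqrtDivSqrt
  refine derivative.ext ?_ ?_
  · simp only [map_sub, Derivation.leibniz, Derivation.leibniz_pow, derivative_X, smul_eq_mul,
      nsmul_eq_mul, Derivation.map_one_eq_zero]
    push_cast
    linear_combination coshSqrt * hc - sinhSqrtDivSqrt * hs
  · simp [constantCoeff_coshSqrt]

open PowerSeries in
-- This is the double-angle formula for $\sinh2\sqrt z/(2\sqrt z)$. With $q$ this product and $r$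
-- playing the role of $\cosh2\sqrt z$, the equations $r'=2q$ and $2zq'=r-q$ give a recursion for
-- the coefficients.
theorem coeff_coshSqrt_mul_sinhSqrtDivSqrt (n : ℕ) :
    coeff n (coshSqrt * sinhSqrtDivSqrt) = 4 ^ n / ((2 * n + 1).factorial : ℚ) := by
  have hc := two_mul_derivative_coshSqrt
  have hs := two_mul_X_mul_derivative_sinhSqrtDivSqrt
  set q := coshSqrt * sinhSqrtDivSqrt with hq
  set r := X * sinhSqrtDivSqrt ^ 2 + coshSqrt ^ 2 with hr
  have h1 : derivative ℚ r = C 2 * q := by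
    simp only [hr, hq, map_add, Derivation.leibniz, Derivation.leibniz_pow, derivative_X,
      smul_eq_mul, nsmul_eq_mul, map_ofNat]
    push_cast
    linear_combination coshSqrt * hc + sinhSqrtDivSqrt * hs
  have h2 : C 2 * (X * derivative ℚ q) = r - q := by
    simp only [hr, hq, Derivation.leibniz, smul_eq_mul, map_ofNat]
    linear_combination X * sinhSqrtDivSqrt * hc + coshSqrt * hs
  have hX : ∀ m, coeff m (X * derivative ℚ q) = m * coeff m q := fun m => by
    cases m with
    | zero => simp
    | succ m => rw [coeff_succ_X_mul, coeff_derivative]; push_cast; ring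
  have h1' : ∀ m : ℕ, coeff (m + 1) r * (m + 1) = 2 * coeff m q := fun m => by
    rw [← coeff_derivative, h1, coeff_C_mul]
  have h2' : ∀ m : ℕ, (2 * m + 1) * coeff m q = coeff m r := fun m => by
    have := congrArg (coeff m) h2
    rw [coeff_C_mul, hX, map_sub] at this
    linear_combination this
  induction n with
  | zero => simp [hq, constantCoeff_coshSqrt, constantCoeff_sinhSqrtDivSqrt]
  | succ n ih =>
    have h3 := h1' n
    rw [← h2', ih] at h3
    rw [show 2 * (n + 1) + 1 = (2 * n + 1) + 1 + 1 by ring, Nat.factorial_succ (2 * n + 1 + 1),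
      Nat.factorial_succ (2 * n + 1)]
    push_cast at h3 ⊢
    have hn : (n + 1 : ℚ) ≠ 0 := by positivity
    have hn' : (2 * (n + 1) + 1 : ℚ) ≠ 0 := by positivity
    have hf : ((2 * n + 1).factorial : ℚ) ≠ 0 := by positivity
    apply mul_left_cancel₀ hn'
    apply mul_right_cancel₀ hn
    rw [h3]
    field_simp
    ring

/-- The coefficients of `2√z / sinh 2√z`. -/
noncomputable def cschCoeff (n : ℕ) : ℚ :=
  16 ^ n * ((Polynomial.bernoulli (2 * n)).eval (1 / 2) / ((2 * n).factorial : ℚ))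

theorem sum_range_two_mul {M : Type*} [AddCommMonoid M] (f : ℕ → M) (n : ℕ) :
    ∑ i ∈ Finset.range (2 * n), f i = ∑ i ∈ Finset.range n, (f (2 * i) + f (2 * i + 1)) := by
  induction n with
  | zero => simp
  | succ n ih => rw [mul_add, mul_one, Finset.sum_range_succ, Finset.sum_range_succ, ih,
      Finset.sum_range_succ, add_assoc]

open PowerSeries in
-- The generating function of the $B_n(1/2)$ is $t/(e^{t/2}-e^{-t/2})$; substituting $t=4\sqrt z$
-- gives $2\sqrt z/\sinh2\sqrt z$.
theorem coshSqrt_mul_sinhSqrtDivSqrt_mul_mk :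
    coshSqrt * sinhSqrtDivSqrt * mk cschCoeff = 1 := by
  have hG := Polynomial.bernoulli_generating_function (1 / 2 : ℚ)
  set G := mk fun n => Polynomial.aeval (1 / 2 : ℚ)
    ((1 / (n.factorial : ℚ)) • Polynomial.bernoulli n) with hGdef
  have he1 : exp ℚ * rescale (-1 / 2) (exp ℚ) = rescale (1 / 2) (exp ℚ) := by
    have := exp_mul_exp_eq_exp_add (A := ℚ) 1 (-1 / 2)
    rw [rescale_one, RingHom.id_apply] at this
    rw [this]
    norm_num
  have he2 : rescale (1 / 2) (exp ℚ) * rescale (-1 / 2) (exp ℚ) = 1 := by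
    have := exp_mul_exp_eq_exp_add (A := ℚ) (1 / 2) (-1 / 2)
    rw [this]
    norm_num [rescale_zero]
  have hX : (rescale (1 / 2) (exp ℚ) - rescale (-1 / 2) (exp ℚ)) * G = X := by
    linear_combination rescale (-1 / 2) (exp ℚ) * hG + X * he2 - G * he1
  ext1 n
  -- As $e^{t/2}-e^{-t/2}$ is odd, only the even-index terms of $G$ survive in an odd degree.
  have h := congrArg (coeff (2 * n + 1)) hX
  rw [coeff_mul, Finset.Nat.sum_antidiagonal_eq_sum_range_succ_mk,
    show (2 * n + 1).succ = 2 * (n + 1) by omega, sum_range_two_mul] at h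
  rw [coeff_mul, Finset.Nat.sum_antidiagonal_eq_sum_range_succ_mk]
  have h16 : coeff n (1 : PowerSeries ℚ) = 16 ^ n * coeff (2 * n + 1) (X : PowerSeries ℚ) := by
    cases n with
    | zero => simp
    | succ n => simp [coeff_X, coeff_one]
  rw [h16, ← h, Finset.mul_sum]
  refine Finset.sum_congr rfl fun i hi => ?_
  have hi' : i ≤ n := Nat.lt_succ_iff.1 (Finset.mem_range.1 hi)
  obtain ⟨m, rfl⟩ := Nat.exists_eq_add_of_le hi'
  rw [coeff_coshSqrt_mul_sinhSqrtDivSqrt, show 2 * (i + m) + 1 - (2 * i + 1) = 2 * m by omega,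
    show i + m - i = m by omega, hGdef]
  simp only [coeff_mk, map_sub, coeff_rescale, coeff_exp, cschCoeff, map_smul,
    Polynomial.coe_aeval_eq_eval, smul_eq_mul, Algebra.algebraMap_self, RingHom.id_apply]
  have e1 : (-1 / 2 : ℚ) ^ (2 * i) = (1 / 2) ^ (2 * i) := by
    rw [pow_mul, pow_mul]; norm_num
  have e2 : (-1 / 2 : ℚ) ^ (2 * i + 1) = -(1 / 2) ^ (2 * i + 1) := by
    rw [pow_succ, pow_succ, e1]; ring
  have e3 : (16 : ℚ) ^ i * ((1 / 2) ^ (2 * i + 1) * 2) = 4 ^ i := by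
    rw [pow_succ, pow_mul, mul_assoc, show (1 / 2 : ℚ) * 2 = 1 by norm_num, mul_one, ← mul_pow]
    norm_num
  rw [e1, e2, ← e3, pow_add]
  ring

open PowerSeries in
-- Write $Q=c/s$ with $c=\cosh\sqrt z$ and $s=\sinh\sqrt z/\sqrt z$. Then $2c'=s$, $2zs'=c-s$ and
-- $c^2-zs^2=1$ give $2zQ'/Q=1-1/(cs)$.
theorem logDerS_sqrtDivTanhSqrt (n : ℕ) :
    logDerS sqrtDivTanhSqrt n = -cschCoeff (n + 1) / 2 := by
  have hc := two_mul_derivative_coshSqrt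
  have hs := two_mul_X_mul_derivative_sinhSqrtDivSqrt
  have h1 := coshSqrt_sq_sub
  have hb := coshSqrt_mul_sinhSqrtDivSqrt_mul_mk
  have hQ : sqrtDivTanhSqrt * sinhSqrtDivSqrt = coshSqrt := by
    rw [sqrtDivTanhSqrt, mul_assoc, PowerSeries.inv_mul_cancel, mul_one]
    rw [constantCoeff_sinhSqrtDivSqrt]
    exact one_ne_zero
  have hs0 : sinhSqrtDivSqrt ≠ 0 := fun h => by
    have := constantCoeff_sinhSqrtDivSqrt
    rw [h] at this
    simp at this
  have hu : 2 * X * mk (fun n => -cschCoeff (n + 1) / 2) = 1 - mk cschCoeff := by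
    ext m
    rw [show (2 : PowerSeries ℚ) = C 2 from (map_ofNat C 2).symm, mul_assoc, coeff_C_mul]
    cases m with
    | zero => simp [cschCoeff]
    | succ m =>
      rw [coeff_succ_X_mul]
      simp [coeff_one]
      ring
  have hD := congrArg (derivative ℚ) hQ
  rw [Derivation.leibniz, smul_eq_mul, smul_eq_mul] at hD
  have key := (mul_logDerS_iff sqrtDivTanhSqrt constantCoeff_sqrtDivTanhSqrt
    (fun n => -cschCoeff (n + 1) / 2)).1 ?_
  · exact (congrFun key n).symm
  · have h20 : (2 : PowerSeries ℚ) ≠ 0 := fun h => by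
      have := congrArg constantCoeff h
      rw [map_ofNat, map_zero] at this
      exact two_ne_zero this
    have h2 : 2 * X * sinhSqrtDivSqrt ^ 2 ≠ 0 :=
      mul_ne_zero (mul_ne_zero h20 X_ne_zero) (pow_ne_zero _ hs0)
    apply mul_left_cancel₀ h2
    linear_combination sqrtDivTanhSqrt * sinhSqrtDivSqrt ^ 2 * hu - hb
      - 2 * X * sinhSqrtDivSqrt * hD + h1 + sqrtDivTanhSqrt * sinhSqrtDivSqrt * hs
      - X * sinhSqrtDivSqrt * hc
      + (coshSqrt - sinhSqrtDivSqrt * mk cschCoeff) * hQ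


/-! ### Passage to the limit -/

theorem summable_prod_fin {r : ℕ} {a : Fin r → ℕ → ℝ} (h0 : ∀ i n, 0 ≤ a i n)
    (ha : ∀ i, Summable (a i)) : Summable fun n : Fin r → ℕ => ∏ i, a i (n i) := by
  classical
  refine summable_of_sum_le (c := ∏ i, ∑' n, a i n)
    (fun n => Finset.prod_nonneg fun i _ => h0 i _) fun u => ?_
  -- A finite set of tuples lies in the box of its projections, and the sum over a box factors.
  have hu : u ⊆ Fintype.piFinset fun i => u.image fun n => n i := fun n hn =>
    Fintype.mem_piFinset.2 fun i => Finset.mem_image_of_mem _ hn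
  refine (Finset.sum_le_sum_of_subset_of_nonneg hu fun n _ _ =>
    Finset.prod_nonneg fun i _ => h0 i _).trans ?_
  rw [← Finset.prod_univ_sum]
  exact Finset.prod_le_prod (fun i _ => Finset.sum_nonneg fun n _ => h0 i n) fun i _ =>
    (ha i).sum_le_tsum _ fun n _ => h0 i n

theorem altTerm_two_mul {r : ℕ} (j : Fin r → ℕ+) (n : Fin r → ℕ) :
    altTerm (fun i => 2 * ((j i : ℕ) : ℝ)) n = ∏ i, ((-1) ^ n i / (n i : ℝ) ^ (2 * (j i : ℕ))) := by
  rw [altTerm, Finset.prod_div_distrib, Finset.prod_pow_eq_pow_sum]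
  congr 1
  refine Finset.prod_congr rfl fun i _ => ?_
  rw [← Real.rpow_natCast]
  push_cast
  rfl

/-- Summability holds on all of $\mathbb N^r$; tuples with a zero entry contribute $0$, since
division by zero gives $0$. -/
theorem summable_altTerm {r : ℕ} (j : Fin r → ℕ+) :
    Summable fun n : Fin r → ℕ => altTerm (fun i => 2 * ((j i : ℕ) : ℝ)) n := by
  refine Summable.of_norm ?_
  have h := summable_prod_fin (a := fun i n => 1 / (n : ℝ) ^ (2 * (j i : ℕ)))
    (fun i n => by positivity) fun i => by
      rw [Real.summable_one_div_nat_pow]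
      have := (j i).pos
      omega
  refine h.congr fun n => ?_
  rw [altTerm_two_mul, norm_prod]
  refine Finset.prod_congr rfl fun i _ => ?_
  rw [norm_div, norm_pow, norm_neg, norm_one, one_pow, norm_pow, Real.norm_natCast]

theorem tendsto_sum_boundedChains {r : ℕ} {f : (Fin r → ℕ) → ℝ} (hf : Summable f) :
    Filter.Tendsto (fun N => ∑ n ∈ boundedChains r N, f n) Filter.atTop
      (nhds (∑' n : chains r, f n)) := by
  classical
  rw [tsum_subtype]
  have h1 : Filter.Tendsto
      (fun N : ℕ => Fintype.piFinset fun _ : Fin r => Finset.range (N + 1))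
      Filter.atTop Filter.atTop := by
    refine Filter.tendsto_atTop_finset_of_monotone (fun a b hab =>
      Fintype.piFinset_subset _ _ fun _ => Finset.range_mono (by omega)) fun n => ?_
    exact ⟨∑ i, n i, Fintype.mem_piFinset.2 fun i => Finset.mem_range.2
      (Nat.lt_succ_of_le (Finset.single_le_sum (fun _ _ => Nat.zero_le _) (Finset.mem_univ i)))⟩
  refine ((hf.indicator (chains r)).hasSum.comp h1).congr fun N => ?_
  rw [Function.comp_apply, boundedChains, Finset.sum_filter]
  refine Finset.sum_congr rfl fun n _ => ?_
  rw [Set.indicator_apply]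

/-- The numbers `(2 / (π v))²`. -/
noncomputable def root (v : ℕ) : ℝ := (2 / (Real.pi * v)) ^ 2

theorem prod_root_eq {r : ℕ} (j : Fin r → ℕ+) (n : Fin r → ℕ) :
    ∏ i, (-(-1) ^ n i * root (n i) ^ (j i : ℕ)) =
      (-1) ^ r * (2 ^ (2 * ∑ i, (j i : ℕ)) / Real.pi ^ (2 * ∑ i, (j i : ℕ))) *
        altTerm (fun i => 2 * ((j i : ℕ) : ℝ)) n := by
  have h : ∀ i, -(-1) ^ n i * root (n i) ^ (j i : ℕ) = (-1) *
      ((2 / Real.pi) ^ (2 * (j i : ℕ)) * ((-1) ^ n i / (n i : ℝ) ^ (2 * (j i : ℕ)))) := fun i => by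
    rw [root, ← pow_mul, div_pow, mul_pow, div_pow, div_mul_eq_div_div]
    ring
  rw [Finset.prod_congr rfl fun i _ => h i, Finset.prod_mul_distrib, Finset.prod_mul_distrib,
    ← altTerm_two_mul, Finset.prod_pow_eq_pow_sum, ← Finset.mul_sum, div_pow, Finset.prod_const,
    Finset.card_univ, Fintype.card_fin, mul_assoc]

theorem tendsto_chainSum {r : ℕ} (j : Fin r → ℕ+) :
    Filter.Tendsto (fun N => chainSum root N j) Filter.atTop
      (nhds ((-1) ^ r * (2 ^ (2 * ∑ i, (j i : ℕ)) / Real.pi ^ (2 * ∑ i, (j i : ℕ))) *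
        T fun i => 2 * ((j i : ℕ) : ℝ))) := by
  simp only [chainSum, prod_root_eq, ← Finset.mul_sum]
  exact (tendsto_sum_boundedChains (summable_altTerm j)).const_mul _

theorem tendsto_symChainSum {r : ℕ} (j : Fin r → ℕ+) :
    Filter.Tendsto (fun N => symChainSum root N j) Filter.atTop
      (nhds ((-1) ^ r * (2 ^ (2 * ∑ i, (j i : ℕ)) / Real.pi ^ (2 * ∑ i, (j i : ℕ))) *
        TSym fun i => 2 * ((j i : ℕ) : ℝ))) := by
  rw [TSym, Finset.mul_sum]
  refine tendsto_finsetSum _ fun σ _ => ?_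
  have h := tendsto_chainSum fun i => j (σ i)
  rwa [Equiv.sum_comp σ fun i => (j i : ℕ)] at h

/-- The Fourier series of $B_{2n+2}$ at $1/2$, where $\cos(\pi v)=(-1)^v$, evaluates the alternating
zeta sum. -/
theorem tendsto_altPowerSum_root (n : ℕ) :
    Filter.Tendsto (fun N => altPowerSum root N n) Filter.atTop
      (nhds (((-1) ^ n * logDerS sqrtDivTanhSqrt n : ℚ) : ℝ)) := by
  have h := (hasSum_one_div_nat_pow_mul_cos (k := n + 1) (by omega) (x := 1 / 2)
    (by norm_num)).mul_left (-(2 / Real.pi) ^ (2 * (n + 1)))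
  -- The index is shifted to start at $v=1$; the removed term at $0$ is zero.
  rw [← hasSum_nat_add_iff' 1] at h
  have hB : Polynomial.eval (1 / 2 : ℝ) (Polynomial.map (algebraMap ℚ ℝ)
      (Polynomial.bernoulli (2 * (n + 1)))) =
      (((Polynomial.bernoulli (2 * (n + 1))).eval (1 / 2) : ℚ) : ℝ) := by
    have := Polynomial.eval_map_apply (f := algebraMap ℚ ℝ) (p := Polynomial.bernoulli (2 * (n + 1)))
      (1 / 2 : ℚ)
    simpa using this
  have h2 := h.tendsto_sum_nat
  convert h2 using 1
  · funext N
    refine Finset.sum_congr rfl fun v _ => ?_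
    have hc : Real.cos (2 * Real.pi * ((v + 1 : ℕ) : ℝ) * (1 / 2)) = (-1) ^ (v + 1) := by
      rw [show 2 * Real.pi * ((v + 1 : ℕ) : ℝ) * (1 / 2) = ((v + 1 : ℕ) : ℝ) * Real.pi by ring,
        Real.cos_nat_mul_pi]
    rw [hc, root, ← pow_mul, div_pow, mul_pow, div_pow]
    have := Real.pi_ne_zero
    field_simp
  · congr 1
    rw [hB, logDerS_sqrtDivTanhSqrt, cschCoeff]
    have := Real.pi_ne_zero
    have h16 : (16 : ℝ) ^ (n + 1) = 2 ^ (2 * (n + 1)) * 2 ^ (2 * (n + 1)) := by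
      rw [pow_mul, ← mul_pow]; norm_num
    push_cast
    rw [h16, div_pow, mul_pow]
    simp only [Finset.sum_range_one, Nat.cast_zero]
    rw [zero_pow (by omega)]
    field_simp
    ring

end Hirz

theorem theorem1 (k r : ℕ) (hk : 1 ≤ k) (j : Fin r → ℕ+) (hanti : Antitone j)
    (hsum : ∑ i, (j i : ℕ) = k) :
    (∀ σ : Equiv.Perm (Fin r),
      Summable fun n : Hirz.chains r => Hirz.altTerm (fun i => 2 * ((j (σ i) : ℕ) : ℝ)) n) ∧
    (Hirz.hirzebruchCoeff k j : ℝ) =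
      (-1) ^ r / (∏ l ∈ Finset.Icc 1 k, ((Hirz.alpha j l).factorial : ℝ)) *
        (2 ^ (2 * k) / Real.pi ^ (2 * k)) *
        Hirz.TSym (fun i => 2 * ((j i : ℕ) : ℝ)) := by
  refine ⟨fun σ => (Hirz.summable_altTerm fun i => j (σ i)).subtype _, ?_⟩
  have h1 := Hirz.tendsto_symChainSum j
  simp only [Hirz.symChainSum_eq_scaledCoeff, Hirz.scaledCoeff, hsum] at h1
  have h2 := (Hirz.tendsto_coeff_hadamardExp Hirz.tendsto_altPowerSum_root k
    (Hirz.exponent j)).const_mul (Hirz.factorialProd (Hirz.exponent j))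
  have h3 := tendsto_nhds_unique h2 h1
  rw [← Hirz.map_hirzebruchL, MvPolynomial.coeff_map, Hirz.factorialProd_exponent j (k := k)
    fun i => hsum ▸ Finset.single_le_sum (f := fun i => (j i : ℕ)) (fun _ _ => Nat.zero_le _)
      (Finset.mem_univ i)] at h3
  have h4 : (∏ l ∈ Finset.Icc 1 k, ((Hirz.alpha j l).factorial : ℝ)) ≠ 0 :=
    Finset.prod_ne_zero_iff.2 fun l _ => by positivity
  rw [div_mul_eq_mul_div, div_mul_eq_mul_div, eq_div_iff h4, ← h3, mul_comm]
  rfl
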